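/- Let $\{|k\rangle\}_{k\ge 0}$ be the Fock basis of the one-mode space $\ell^2(\mathbb{N},\mathbb{C})$, let $|\alpha\rangle=e^{-|\alpha|^2/2}\sum_{k\ge0}\frac{\alpha^k}{\sqrt{k!}}|k\rangle$ ($\alpha\in\mathbb{C}$) be the coherent states, and for a complex random variable $X$ let $\rho_X=\mathbb{E}\big[|X\rangle\langle X|\big]$ be the corresponding mixture of coherent states, which is a density operator (positive, of trace one). Let $\bar m>0$, let $X_G$ be circularly symmetric complex Gaussian, $X_G\sim\mathcal{CN}(0,\bar m)$ (density $\frac{1}{\pi\bar m}e^{-|z|^2/\bar m}$), and let $P_d=\sum_{k=0}^{d-1}|k\rangle\langle k|$ be the projection onto the first $d$ Fock states. Then $\rho_{X_G}$ is the thermal state with mean photon number $\bar m$, $$\rho_{X_G}=\sum_{k\ge0}\frac{\bar m^k}{(\bar m+1)^{k+1}}|k\rangle\langle k|,\qquad \operatorname{Tr}\big[\rho_{X_G}(I-P_d)\big]=\Big(\frac{\bar m}{\bar m+1}\Big)^d\quad(d\ge0).$$ Let $(\rho_{X_n})_n$ be mixtures of coherent states (or, more generally, any density operators) converging weakly to $\rho_{X_G}$,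 that is, $\langle f,\rho_{X_n}g\rangle\to\langle f,\rho_{X_G}g\rangle$ for all vectors $f,g$. Then for every $d\ge0$ there is an $N$ such that for all $n\ge N$ $$\|\rho_{X_n}-\rho_{X_G}\|_1\le 6\Big(\frac{\bar m}{\bar m+1}\Big)^d,$$ where $\|T\|_1=\operatorname{Tr}\sqrt{T^*T}$ is the trace norm. In this sense $\|\rho_{X_n}-\rho_{X_G}\|_1=O\big((\frac{\bar m}{\bar m+1})^d\big)$, with a constant that depends neither on $d$, nor on $\bar m$, nor on the sequence. -/

import Mathlib

open MeasureTheory Filter Topology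
open scoped ENNReal

noncomputable section

/-- The Hilbert space of one bosonic mode, in the number representation: `ℓ²(ℕ, ℂ)`. -/
def FockSpace : Type := lp (fun _ : ℕ => ℂ) 2

instance : NormedAddCommGroup FockSpace :=
  inferInstanceAs (NormedAddCommGroup (lp (fun _ : ℕ => ℂ) 2))

instance : InnerProductSpace ℂ FockSpace :=
  inferInstanceAs (InnerProductSpace ℂ (lp (fun _ : ℕ => ℂ) 2))

instance : CompleteSpace FockSpace :=
  inferInstanceAs (CompleteSpace (lp (fun _ : ℕ => ℂ) 2))

/-- The Fock (number) state `|k⟩`. -/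
def fockState (k : ℕ) : FockSpace := (lp.single 2 k (1 : ℂ) : lp (fun _ : ℕ => ℂ) 2)

/-- The rank-one operator `|f⟩⟨f|`. -/
def ketbra (f : FockSpace) : FockSpace →L[ℂ] FockSpace := InnerProductSpace.rankOne ℂ f f

/-- The coefficients of a coherent state in the Fock basis are square summable. -/
theorem memℓp_coherent (α : ℂ) :
    Memℓp (fun k : ℕ =>
      ((Real.exp (-‖α‖ ^ 2 / 2) : ℝ) : ℂ) * (α ^ k / ((√(k.factorial : ℝ) : ℝ) : ℂ))) 2 := by
  refine memℓp_gen ?_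
  have h := (Real.summable_pow_div_factorial (‖α‖ ^ 2)).mul_left ((Real.exp (-‖α‖ ^ 2 / 2)) ^ 2)
  refine h.congr fun k => ?_
  have hk : (0 : ℝ) ≤ (k.factorial : ℝ) := Nat.cast_nonneg _
  have h2 : (2 : ℝ≥0∞).toReal = ((2 : ℕ) : ℝ) := by norm_num
  rw [h2, Real.rpow_natCast, norm_mul, norm_div, norm_pow, Complex.norm_real, Complex.norm_real,
    Real.norm_of_nonneg (Real.exp_pos _).le, Real.norm_of_nonneg (Real.sqrt_nonneg _), mul_pow,
    div_pow, Real.sq_sqrt hk, ← pow_mul, ← pow_mul, mul_comm 2 k]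

/-- The coherent state `|α⟩ = e^{-|α|²/2} ∑ₖ (αᵏ / √(k!)) |k⟩`. -/
def coherentState (α : ℂ) : FockSpace := (⟨_, memℓp_coherent α⟩ : lp (fun _ : ℕ => ℂ) 2)

/-- The mixture `ρ_X = ∫ |x⟩⟨x| dμ(x)` of coherent states, where `μ` is the law of the
complex random variable `X` (a Bochner integral with respect to the operator norm). -/
def coherentMixture (μ : Measure ℂ) : FockSpace →L[ℂ] FockSpace :=
  ∫ x, ketbra (coherentState x) ∂μ

/-- For a finite constellation `s` with weights `p`, the mixture is `∑ p(x) |x⟩⟨x|`. -/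
theorem coherentMixture_finite (s : Finset ℂ) (p : ℂ → ℝ) (hp : ∀ x ∈ s, 0 ≤ p x) :
    coherentMixture (∑ x ∈ s, ENNReal.ofReal (p x) • Measure.dirac x) =
      ∑ x ∈ s, ((p x : ℝ) : ℂ) • ketbra (coherentState x) := by
  have hi : ∀ x ∈ s, Integrable (fun y => ketbra (coherentState y))
      (ENNReal.ofReal (p x) • Measure.dirac x) := fun x _ =>
    (integrable_dirac enorm_lt_top).smul_measure ENNReal.ofReal_ne_top
  rw [coherentMixture, integral_finsetSum_measure hi]
  refine Finset.sum_congr rfl fun x hx => ?_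
  rw [integral_smul_measure, integral_dirac, ENNReal.toReal_ofReal (hp x hx)]
  rfl

/-- The circularly symmetric complex Gaussian law `𝒞𝒩(0, m)`, whose density is
`(π m)⁻¹ exp(-|z|² / m)`. -/
def complexGaussian (m : ℝ) : Measure ℂ :=
  (volume : Measure ℂ).withDensity fun z =>
    ENNReal.ofReal ((Real.pi * m)⁻¹ * Real.exp (-‖z‖ ^ 2 / m))

/-- The state `ρ_{X_G}`: the Gaussian mixture of coherent states, `X_G ∼ 𝒞𝒩(0, m)`. -/
def gaussianState (m : ℝ) : FockSpace →L[ℂ] FockSpace := coherentMixture (complexGaussian m)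

/-- The projection `P_d = ∑_{k < d} |k⟩⟨k|` onto the span of the first `d` Fock states. -/
def fockProj (d : ℕ) : FockSpace →L[ℂ] FockSpace := ∑ k ∈ Finset.range d, ketbra (fockState k)

/-- The trace norm `‖T‖₁ = Tr |T|`, `|T| = √(T* T)`, as a value in `[0, ∞]`; it is finite exactly
on the trace-class operators. -/
def traceNorm (T : FockSpace →L[ℂ] FockSpace) : ℝ≥0∞ :=
  ∑' k : ℕ, ENNReal.ofReal (inner ℂ (fockState k) (CFC.abs T (fockState k))).re

/-- `T` is of trace class and its trace is `t`. -/
def HasTrace (T : FockSpace →L[ℂ] FockSpace) (t : ℂ) : Prop :=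
  traceNorm T < ∞ ∧ HasSum (fun k : ℕ => inner ℂ (fockState k) (T (fockState k))) t

/-- Density operators: positive operators of trace one. -/
def IsDensityOperator (T : FockSpace →L[ℂ] FockSpace) : Prop :=
  T.IsPositive ∧ HasTrace T 1

/-- Weak convergence of operators: convergence in the weak operator topology, that is,
`⟨f, ρ n g⟩ → ⟨f, σ g⟩` for all vectors `f` and `g`. -/
def WeaklyConverges (ρ : ℕ → FockSpace →L[ℂ] FockSpace) (σ : FockSpace →L[ℂ] FockSpace) : Prop :=
  Tendsto (fun n => ContinuousLinearMapWOT.ofCLM (ρ n)) atTop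
    (𝓝 (ContinuousLinearMapWOT.ofCLM σ))

end

/-! The thermal form of the Gaussian mixture comes from rotation invariance, which kills the
off-diagonal Fock entries, and from a Gamma integral on the diagonal; the tail trace is then a
geometric series.

The error bound rests on a general fact, `WeaklyConverges.tendsto_traceNorm_sub`: density operators
that converge weakly to a density operator converge in trace norm. Cut everything down by `fockProj
d`. The compressed difference has finitely many matrix entries, each tending to zero. What is cut
off costs at most twice the square root of the tail weight
(`IsDensityOperator.dualTraceNorm_sub_compress_le`). Because all traces are one, a tail weight is
one minus a finite sum of diagonal entries, so it also passes to the weak limit and no mass escapes.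
For fixed `m` and `d` the required bound is a positive number, hence eventually met.

The triangle inequality is not visible from the definition through `|T|`, so estimates are made for
a supremum over contractions, which dominates `traceNorm` on self-adjoint operators and is
controlled by Hilbert–Schmidt norms. -/

/-! ### Fock basis and Parseval -/

/-- The Fock states as a Hilbert basis. -/
noncomputable def fockBasis : HilbertBasis ℕ ℂ FockSpace :=
  ⟨(LinearIsometryEquiv.refl ℂ (lp (fun _ : ℕ => ℂ) 2) : FockSpace ≃ₗᵢ[ℂ] lp (fun _ : ℕ => ℂ) 2)⟩

theorem fockBasis_apply (k : ℕ) : fockBasis k = fockState k :=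
  (fockBasis.repr_symm_single k).symm

theorem orthonormal_fockState : Orthonormal ℂ fockState :=
  (funext fockBasis_apply : ⇑fockBasis = fockState) ▸ fockBasis.orthonormal

theorem norm_fockState (k : ℕ) : ‖fockState k‖ = 1 := orthonormal_fockState.1 k

theorem inner_fockState_fockState (j k : ℕ) :
    inner ℂ (fockState j) (fockState k) = if j = k then (1 : ℂ) else 0 :=
  orthonormal_iff_ite.mp orthonormal_fockState j k

theorem hasSum_norm_inner_fockState_sq (f : FockSpace) :
    HasSum (fun k => ‖(inner ℂ (fockState k) f : ℂ)‖ ^ 2) (‖f‖ ^ 2) := by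
  have h := (fockBasis.hasSum_inner_mul_inner f f).mapL Complex.reCLM
  convert! h using 1
  · ext k
    simp only [Complex.reCLM_apply, fockBasis_apply]
    rw [← inner_conj_symm f, mul_comm, Complex.mul_conj, Complex.normSq_eq_norm_sq,
      Complex.ofReal_re]
  · rw [inner_self_eq_norm_sq_to_K]
    norm_cast

theorem tsum_enorm_inner_fockState_sq (f : FockSpace) :
    ∑' k, ‖(inner ℂ (fockState k) f : ℂ)‖ₑ ^ 2 = ‖f‖ₑ ^ 2 := by
  have h := hasSum_norm_inner_fockState_sq f
  simp_rw [← ofReal_norm, ← ENNReal.ofReal_pow (norm_nonneg _)]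
  rw [← h.tsum_eq, ENNReal.ofReal_tsum_of_nonneg (fun _ => by positivity) h.summable]

theorem ENNReal.tsum_mul_le_sqrt_mul_sqrt {ι : Type*} (f g : ι → ℝ≥0∞) :
    ∑' i, f i * g i ≤ (∑' i, f i ^ 2) ^ (1 / 2 : ℝ) * (∑' i, g i ^ 2) ^ (1 / 2 : ℝ) := by
  refine ENNReal.summable.tsum_le_of_sum_le fun s => ?_
  refine (ENNReal.inner_le_Lp_mul_Lq s f g Real.HolderConjugate.two_two).trans ?_
  simp only [ENNReal.rpow_ofNat]
  gcongr <;> exact ENNReal.sum_le_tsum s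

/-! ### Hilbert–Schmidt norm -/

/-- The square of the Hilbert–Schmidt norm. -/
noncomputable def hilbertSchmidtSq (A : FockSpace →L[ℂ] FockSpace) : ℝ≥0∞ :=
  ∑' k, ‖A (fockState k)‖ₑ ^ 2

theorem hilbertSchmidtSq_eq_tsum_tsum (A : FockSpace →L[ℂ] FockSpace) :
    hilbertSchmidtSq A = ∑' k, ∑' j, ‖(inner ℂ (fockState j) (A (fockState k)) : ℂ)‖ₑ ^ 2 := by
  simp_rw [tsum_enorm_inner_fockState_sq, hilbertSchmidtSq]

/-- The double sum of squared matrix entries is unchanged by conjugate transposition. This lets a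
contraction be absorbed on the right as well as on the left. -/
theorem hilbertSchmidtSq_star (A : FockSpace →L[ℂ] FockSpace) :
    hilbertSchmidtSq (star A) = hilbertSchmidtSq A := by
  rw [hilbertSchmidtSq_eq_tsum_tsum, ENNReal.tsum_comm, hilbertSchmidtSq_eq_tsum_tsum A]
  refine tsum_congr fun j => tsum_congr fun k => ?_
  rw [ContinuousLinearMap.star_eq_adjoint, ContinuousLinearMap.adjoint_inner_right,
    ← inner_conj_symm, RCLike.enorm_conj]

theorem hilbertSchmidtSq_mul_le_right (C A : FockSpace →L[ℂ] FockSpace) (hC : ‖C‖ ≤ 1) :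
    hilbertSchmidtSq (C * A) ≤ hilbertSchmidtSq A := by
  refine ENNReal.tsum_le_tsum fun k => ?_
  gcongr
  refine enorm_le_iff_norm_le.mpr ((C.le_opNorm _).trans ?_)
  exact mul_le_of_le_one_left (norm_nonneg _) hC

theorem hilbertSchmidtSq_mul_le_left (A C : FockSpace →L[ℂ] FockSpace) (hC : ‖C‖ ≤ 1) :
    hilbertSchmidtSq (A * C) ≤ hilbertSchmidtSq A := by
  rw [← hilbertSchmidtSq_star, star_mul, ← hilbertSchmidtSq_star A]
  exact hilbertSchmidtSq_mul_le_right _ _ (by rwa [norm_star])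

/-! ### Trace norm and its dual form -/

/-- The trace norm by duality with the contractions. -/
noncomputable def dualTraceNorm (T : FockSpace →L[ℂ] FockSpace) : ℝ≥0∞ :=
  ⨆ C : {C : FockSpace →L[ℂ] FockSpace // ‖C‖ ≤ 1},
    ∑' k, ‖(inner ℂ (C.1 (fockState k)) (T (fockState k)) : ℂ)‖ₑ

theorem dualTraceNorm_add_le (S T : FockSpace →L[ℂ] FockSpace) :
    dualTraceNorm (S + T) ≤ dualTraceNorm S + dualTraceNorm T := by
  refine iSup_le fun C => ?_
  refine le_trans ?_ (add_le_add (le_iSup _ C) (le_iSup _ C))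
  rw [← ENNReal.tsum_add]
  refine ENNReal.tsum_le_tsum fun k => ?_
  rw [add_apply, inner_add_right]
  exact enorm_add_le _ _

theorem dualTraceNorm_neg (T : FockSpace →L[ℂ] FockSpace) :
    dualTraceNorm (-T) = dualTraceNorm T := by
  simp [dualTraceNorm, inner_neg_right]

/-- Cauchy–Schwarz twice, in the Hilbert space and in the sum over `k`, once `A` has been moved onto
the contraction. -/
theorem dualTraceNorm_star_mul_le (A B : FockSpace →L[ℂ] FockSpace) :
    dualTraceNorm (star A * B) ≤
      hilbertSchmidtSq A ^ (1 / 2 : ℝ) * hilbertSchmidtSq B ^ (1 / 2 : ℝ) := by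
  refine iSup_le fun C => ?_
  calc ∑' k, ‖(inner ℂ (C.1 (fockState k)) ((star A * B) (fockState k)) : ℂ)‖ₑ
      ≤ ∑' k, ‖(A * C.1) (fockState k)‖ₑ * ‖B (fockState k)‖ₑ := by
        refine ENNReal.tsum_le_tsum fun k => ?_
        rw [mul_apply_eq_comp, ContinuousLinearMap.star_eq_adjoint,
          ContinuousLinearMap.adjoint_inner_right, ← enorm_norm (A * C.1 <| _),
          ← enorm_norm (B _), ← enorm_mul]
        refine enorm_le_iff_norm_le.mpr ?_
        rw [norm_mul, norm_norm, norm_norm]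
        exact norm_inner_le_norm _ _
    _ ≤ _ := ENNReal.tsum_mul_le_sqrt_mul_sqrt _ _
    _ ≤ _ := by
        gcongr
        · exact hilbertSchmidtSq_mul_le_left A C.1 C.2
        · exact le_rfl

/-- The continuous function `x / (|x| + ε)` replaces the sign of `x`, so continuous functional
calculus does the work of the polar decomposition; the error `ε |x| / (|x| + ε)` is at most `ε`. -/
theorem exists_contraction_norm_abs_sub_le (T : FockSpace →L[ℂ] FockSpace)
    (hT : IsSelfAdjoint T) {ε : ℝ} (hε : 0 < ε) :
    ∃ C : FockSpace →L[ℂ] FockSpace, ‖C‖ ≤ 1 ∧ IsSelfAdjoint C ∧ ‖CFC.abs T - C * T‖ ≤ ε := by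
  have hpos : ∀ x : ℝ, |x| + ε ≠ 0 := fun x => by positivity
  have hc : Continuous fun x : ℝ => x / (|x| + ε) :=
    continuous_id.div (by fun_prop) hpos
  refine ⟨cfc (fun x : ℝ => x / (|x| + ε)) T, norm_cfc_le zero_le_one fun x _ => ?_,
    cfc_predicate _ T, ?_⟩
  · rw [Real.norm_eq_abs, abs_div, abs_of_nonneg (by positivity : 0 ≤ |x| + ε)]
    exact div_le_one_of_le₀ (by linarith) (by positivity)
  · have h : CFC.abs T - cfc (fun x : ℝ => x / (|x| + ε)) T * T =
        cfc (fun x : ℝ => ‖x‖ - x / (|x| + ε) * x) T := by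
      rw [cfc_sub (fun x : ℝ => ‖x‖) (fun x => x / (|x| + ε) * x) T (by fun_prop)
        (hc.mul continuous_id).continuousOn, CFC.abs_eq_cfc_norm T hT,
        cfc_mul (fun x : ℝ => x / (|x| + ε)) (fun x => x) T hc.continuousOn, cfc_id' ℝ T]
    rw [h]
    refine norm_cfc_le hε.le fun x _ => ?_
    have : ‖x‖ - x / (|x| + ε) * x = ε * (|x| / (|x| + ε)) := by
      rw [Real.norm_eq_abs]
      field_simp [hpos x]
      rw [← sq_abs x]
      ring
    rw [this, norm_mul, Real.norm_of_nonneg hε.le, Real.norm_of_nonneg (by positivity)]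
    exact mul_le_of_le_one_right hε.le (div_le_one_of_le₀ (by linarith) (by positivity))

theorem traceNorm_le_dualTraceNorm (T : FockSpace →L[ℂ] FockSpace) (hT : IsSelfAdjoint T) :
    traceNorm T ≤ dualTraceNorm T := by
  -- The approximation costs `ε` per basis vector, so the number `n` of terms is fixed before `ε`
  -- tends to zero.
  refine ENNReal.summable.tsum_le_of_sum_range_le fun n => ?_
  have key : ∀ ε : ℝ, 0 < ε →
      ∑ k ∈ Finset.range n, ENNReal.ofReal (inner ℂ (fockState k) (CFC.abs T (fockState k))).re ≤
        dualTraceNorm T + n * ENNReal.ofReal ε := by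
    intro ε hε
    obtain ⟨C, hC, hCs, hCT⟩ := exists_contraction_norm_abs_sub_le T hT hε
    have hle : ∀ k, ENNReal.ofReal (inner ℂ (fockState k) (CFC.abs T (fockState k))).re ≤
        ‖(inner ℂ (C (fockState k)) (T (fockState k)) : ℂ)‖ₑ + ENNReal.ofReal ε := by
      intro k
      rw [← ofReal_norm, ← ENNReal.ofReal_add (norm_nonneg _) hε.le]
      refine ENNReal.ofReal_le_ofReal ((Complex.re_le_norm _).trans ?_)
      have h1 : (inner ℂ (fockState k) (CFC.abs T (fockState k)) : ℂ) =
          inner ℂ (C (fockState k)) (T (fockState k)) +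
            inner ℂ (fockState k) ((CFC.abs T - C * T) (fockState k)) := by
        rw [sub_apply, inner_sub_right, mul_apply_eq_comp,
          ← ContinuousLinearMap.adjoint_inner_left C, hCs.adjoint_eq]
        ring
      rw [h1]
      refine (norm_add_le _ _).trans (add_le_add le_rfl ((norm_inner_le_norm _ _).trans ?_))
      rw [norm_fockState, one_mul]
      refine (ContinuousLinearMap.le_opNorm _ _).trans ?_
      rwa [norm_fockState, mul_one]
    calc _ ≤ ∑ k ∈ Finset.range n,
          (‖(inner ℂ (C (fockState k)) (T (fockState k)) : ℂ)‖ₑ + ENNReal.ofReal ε) :=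
          Finset.sum_le_sum fun k _ => hle k
      _ = ∑ k ∈ Finset.range n, ‖(inner ℂ (C (fockState k)) (T (fockState k)) : ℂ)‖ₑ +
          n * ENNReal.ofReal ε := by simp [Finset.sum_add_distrib]
      _ ≤ _ := add_le_add ((ENNReal.sum_le_tsum _).trans (le_iSup
          (fun C : {C : FockSpace →L[ℂ] FockSpace // ‖C‖ ≤ 1} =>
            ∑' k, ‖(inner ℂ (C.1 (fockState k)) (T (fockState k)) : ℂ)‖ₑ) ⟨C, hC⟩)) le_rfl
  have hlim : Tendsto (fun ε : ℝ => dualTraceNorm T + n * ENNReal.ofReal ε) (𝓝[>] 0)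
      (𝓝 (dualTraceNorm T + n * ENNReal.ofReal 0)) := by
    refine Tendsto.mono_left ?_ nhdsWithin_le_nhds
    refine tendsto_const_nhds.add (ENNReal.Tendsto.const_mul ?_ (Or.inr (ENNReal.natCast_ne_top n)))
    exact ENNReal.tendsto_ofReal tendsto_id
  simpa using ge_of_tendsto hlim (eventually_mem_nhdsWithin.mono key)

theorem traceNorm_of_isPositive {T : FockSpace →L[ℂ] FockSpace} (hT : T.IsPositive) :
    traceNorm T = ∑' k, ENNReal.ofReal (inner ℂ (fockState k) (T (fockState k))).re := by
  rw [traceNorm, CFC.abs_of_nonneg T ((ContinuousLinearMap.nonneg_iff_isPositive T).mpr hT)]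

theorem hasTrace_of_isPositive {T : FockSpace →L[ℂ] FockSpace} (hT : T.IsPositive) {t : ℝ}
    (ht : HasSum (fun k => (inner ℂ (fockState k) (T (fockState k))).re) t) :
    HasTrace T (t : ℂ) := by
  have hre : ∀ k, 0 ≤ (inner ℂ (fockState k) (T (fockState k)) : ℂ).re := fun k =>
    hT.re_inner_nonneg_right _
  refine ⟨?_, ?_⟩
  · rw [traceNorm_of_isPositive hT, ← ENNReal.ofReal_tsum_of_nonneg hre ht.summable]
    exact ENNReal.ofReal_lt_top
  · convert! Complex.hasSum_ofReal.mpr ht using 2 with k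
    exact Complex.eq_re_of_ofReal_le (r := 0) (by simpa using hT.inner_nonneg_right (fockState k))
-- Compression to the first Fock states
theorem isSelfAdjoint_fockProj (d : ℕ) : IsSelfAdjoint (fockProj d) :=
  (ContinuousLinearMap.isPositive_sum _ fun k _ =>
    InnerProductSpace.isPositive_rankOne_self (𝕜 := ℂ) (fockState k)).isSelfAdjoint

theorem ketbra_fockState_apply (j k : ℕ) :
    ketbra (fockState j) (fockState k) = if j = k then fockState k else 0 := by
  rw [ketbra, InnerProductSpace.rankOne_apply, inner_fockState_fockState]
  split_ifs with h <;> simp [h]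

theorem fockProj_fockState (d k : ℕ) :
    fockProj d (fockState k) = if k < d then fockState k else 0 := by
  simp [fockProj, ketbra_fockState_apply]

/-- Turns diagonal entries of a state, hence traces and tail weights, into Hilbert–Schmidt norms of
its square root. -/
theorem enorm_sqrt_fockState_sq {ρ : FockSpace →L[ℂ] FockSpace} (hρ : ρ.IsPositive) (k : ℕ) :
    ‖CFC.sqrt ρ (fockState k)‖ₑ ^ 2 =
      ENNReal.ofReal (inner ℂ (fockState k) (ρ (fockState k))).re := by
  have h0 : 0 ≤ ρ := (ContinuousLinearMap.nonneg_iff_isPositive ρ).mpr hρ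
  have hs : IsSelfAdjoint (CFC.sqrt ρ) := (CFC.sqrt_nonneg ρ).isSelfAdjoint
  rw [← ofReal_norm, ← ENNReal.ofReal_pow (norm_nonneg _)]
  congr 1
  conv_rhs => rw [← CFC.sqrt_mul_sqrt_self ρ h0]
  rw [mul_apply_eq_comp, ← ContinuousLinearMap.adjoint_inner_left, hs.adjoint_eq,
    inner_self_eq_norm_sq_to_K]
  norm_cast

/-- The weight of a state of trace one outside the range of `fockProj d`. -/
noncomputable def tailWeight (ρ : FockSpace →L[ℂ] FockSpace) (d : ℕ) : ℝ≥0∞ :=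
  1 - ∑ k ∈ Finset.range d, ENNReal.ofReal (inner ℂ (fockState k) (ρ (fockState k))).re

theorem IsDensityOperator.tsum_eq_one {ρ : FockSpace →L[ℂ] FockSpace}
    (hρ : IsDensityOperator ρ) :
    ∑' k, ENNReal.ofReal (inner ℂ (fockState k) (ρ (fockState k))).re = 1 := by
  have h := hρ.2.2.mapL Complex.reCLM
  rw [← ENNReal.ofReal_tsum_of_nonneg (fun k =>
    show 0 ≤ (inner ℂ (fockState k) (ρ (fockState k)) : ℂ).re from hρ.1.re_inner_nonneg_right _)
    h.summable]
  have := h.tsum_eq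
  simp only [Complex.reCLM_apply, Complex.one_re] at this
  rw [this, ENNReal.ofReal_one]

theorem IsDensityOperator.hilbertSchmidtSq_sqrt {ρ : FockSpace →L[ℂ] FockSpace}
    (hρ : IsDensityOperator ρ) : hilbertSchmidtSq (CFC.sqrt ρ) = 1 := by
  simp_rw [hilbertSchmidtSq, enorm_sqrt_fockState_sq hρ.1, hρ.tsum_eq_one]

theorem hilbertSchmidtSq_mul_fockProj (A : FockSpace →L[ℂ] FockSpace) (d : ℕ) :
    hilbertSchmidtSq (A * fockProj d) = ∑ k ∈ Finset.range d, ‖A (fockState k)‖ₑ ^ 2 := by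
  rw [hilbertSchmidtSq, tsum_eq_sum (s := Finset.range d)]
  · refine Finset.sum_congr rfl fun k hk => ?_
    rw [mul_apply_eq_comp, fockProj_fockState, if_pos (Finset.mem_range.mp hk)]
  · intro k hk
    rw [mul_apply_eq_comp, fockProj_fockState, if_neg (by simpa using hk)]
    simp

theorem hilbertSchmidtSq_mul_fockProj_add (A : FockSpace →L[ℂ] FockSpace) (d : ℕ) :
    hilbertSchmidtSq (A * fockProj d) + hilbertSchmidtSq (A * (1 - fockProj d)) =
      hilbertSchmidtSq A := by
  rw [hilbertSchmidtSq, hilbertSchmidtSq, ← ENNReal.tsum_add]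
  refine tsum_congr fun k => ?_
  simp only [mul_apply_eq_comp, sub_apply, one_apply_eq_self, fockProj_fockState]
  split_ifs <;> simp

theorem IsDensityOperator.hilbertSchmidtSq_sqrt_mul {ρ : FockSpace →L[ℂ] FockSpace}
    (hρ : IsDensityOperator ρ) (d : ℕ) :
    hilbertSchmidtSq (CFC.sqrt ρ * (1 - fockProj d)) = tailWeight ρ d := by
  have h := hilbertSchmidtSq_mul_fockProj_add (CFC.sqrt ρ) d
  rw [hρ.hilbertSchmidtSq_sqrt, hilbertSchmidtSq_mul_fockProj] at h
  simp_rw [enorm_sqrt_fockState_sq hρ.1] at h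
  exact ENNReal.eq_sub_of_add_eq' ENNReal.one_ne_top ((add_comm _ _).trans h)

/-- Cutting a density operator down to the first Fock states changes it little in trace norm
when its weight outside of them is small. -/
theorem IsDensityOperator.dualTraceNorm_sub_compress_le {ρ : FockSpace →L[ℂ] FockSpace}
    (hρ : IsDensityOperator ρ) (d : ℕ) :
    dualTraceNorm (ρ - fockProj d * ρ * fockProj d) ≤ 2 * tailWeight ρ d ^ (1 / 2 : ℝ) := by
  set P := fockProj d
  set S := CFC.sqrt ρ
  have hP : star P = P := isSelfAdjoint_fockProj d
  have hS : star S = S := (CFC.sqrt_nonneg ρ).isSelfAdjoint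
  have hSS : S * S = ρ :=
    CFC.sqrt_mul_sqrt_self ρ ((ContinuousLinearMap.nonneg_iff_isPositive ρ).mpr hρ.1)
  have hS1 : hilbertSchmidtSq S = 1 := hρ.hilbertSchmidtSq_sqrt
  have hSP : hilbertSchmidtSq (S * P) ≤ 1 := by
    rw [← hS1, ← hilbertSchmidtSq_mul_fockProj_add S d]
    exact le_self_add
  have hSQ : hilbertSchmidtSq (S * (1 - P)) = tailWeight ρ d := hρ.hilbertSchmidtSq_sqrt_mul d
  -- The two terms are `(1 - P) ρ` and `P ρ (1 - P)`. With `ρ = S * S`, each has one factor of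
  -- Hilbert–Schmidt norm at most one and one whose squared norm is the tail weight.
  have hdec : ρ - P * ρ * P = star (S * (1 - P)) * S + star (S * P) * (S * (1 - P)) := by
    rw [star_mul, star_mul, star_sub, star_one, hP, hS, ← hSS]
    noncomm_ring
  rw [hdec, two_mul]
  refine (dualTraceNorm_add_le _ _).trans (add_le_add ?_ ?_)
  · refine (dualTraceNorm_star_mul_le _ _).trans ?_
    rw [hS1, hSQ, ENNReal.one_rpow, mul_one]
  · refine (dualTraceNorm_star_mul_le _ _).trans ?_
    rw [hSQ]
    exact mul_le_of_le_one_left zero_le (ENNReal.rpow_le_one hSP (by norm_num))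

theorem hilbertSchmidtSq_compress (T : FockSpace →L[ℂ] FockSpace) (d : ℕ) :
    hilbertSchmidtSq (fockProj d * T * fockProj d) = ∑ k ∈ Finset.range d,
      ∑ j ∈ Finset.range d, ‖(inner ℂ (fockState j) (T (fockState k)) : ℂ)‖ₑ ^ 2 := by
  rw [hilbertSchmidtSq_mul_fockProj]
  refine Finset.sum_congr rfl fun k _ => ?_
  rw [← tsum_enorm_inner_fockState_sq, tsum_eq_sum (s := Finset.range d)]
  · refine Finset.sum_congr rfl fun j hj => ?_
    rw [mul_apply_eq_comp, ← ContinuousLinearMap.adjoint_inner_left,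
      (isSelfAdjoint_fockProj d).adjoint_eq, fockProj_fockState, if_pos (Finset.mem_range.mp hj)]
  · intro j hj
    rw [mul_apply_eq_comp, ← ContinuousLinearMap.adjoint_inner_left,
      (isSelfAdjoint_fockProj d).adjoint_eq, fockProj_fockState, if_neg (by simpa using hj)]
    simp

theorem hilbertSchmidtSq_fockProj (d : ℕ) : hilbertSchmidtSq (fockProj d) = d := by
  rw [← one_mul (fockProj d), hilbertSchmidtSq_mul_fockProj]
  simp [← ofReal_norm, norm_fockState]

/-- Splitting off a further factor `fockProj d`, of squared Hilbert–Schmidt norm `d`, bounds the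
block by its entries. The factor `√d` is harmless because `d` stays fixed in the limit. -/
theorem dualTraceNorm_compress_le (T : FockSpace →L[ℂ] FockSpace) (d : ℕ) :
    dualTraceNorm (fockProj d * T * fockProj d) ≤ (d : ℝ≥0∞) ^ (1 / 2 : ℝ) *
      (∑ k ∈ Finset.range d, ∑ j ∈ Finset.range d,
        ‖(inner ℂ (fockState j) (T (fockState k)) : ℂ)‖ₑ ^ 2) ^ (1 / 2 : ℝ) := by
  have hPP : fockProj d * fockProj d = fockProj d := by
    nth_rw 2 [fockProj]
    rw [Finset.mul_sum, fockProj]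
    refine Finset.sum_congr rfl fun k hk => ?_
    rw [← fockProj, ketbra, ContinuousLinearMap.mul_def, InnerProductSpace.comp_rankOne,
      fockProj_fockState, if_pos (Finset.mem_range.mp hk)]
  have h := dualTraceNorm_star_mul_le (fockProj d) (fockProj d * T * fockProj d)
  rwa [(isSelfAdjoint_fockProj d).star_eq, ← mul_assoc, ← mul_assoc, hPP,
    hilbertSchmidtSq_compress, hilbertSchmidtSq_fockProj] at h

/-! ### From weak convergence to trace norm convergence -/

theorem WeaklyConverges.tendsto_inner {ρ : ℕ → FockSpace →L[ℂ] FockSpace}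
    {σ : FockSpace →L[ℂ] FockSpace} (h : WeaklyConverges ρ σ) (f g : FockSpace) :
    Tendsto (fun n => (inner ℂ f (ρ n g) : ℂ)) atTop (𝓝 (inner ℂ f (σ g))) :=
  ContinuousLinearMapWOT.tendsto_iff_forall_dual_apply_tendsto.mp h g (innerSL ℂ f)

theorem IsDensityOperator.tendsto_tailWeight_atTop {σ : FockSpace →L[ℂ] FockSpace}
    (hσ : IsDensityOperator σ) : Tendsto (tailWeight σ) atTop (𝓝 0) := by
  have h := (ENNReal.summable (f := fun k =>
    ENNReal.ofReal (inner ℂ (fockState k) (σ (fockState k))).re)).hasSum.tendsto_sum_nat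
  rw [hσ.tsum_eq_one] at h
  change Tendsto (fun d => tailWeight σ d) atTop (𝓝 0)
  simpa [tailWeight] using
    ENNReal.Tendsto.sub (tendsto_const_nhds (x := (1 : ℝ≥0∞))) h (Or.inl ENNReal.one_ne_top)

theorem WeaklyConverges.tendsto_tailWeight {ρ : ℕ → FockSpace →L[ℂ] FockSpace}
    {σ : FockSpace →L[ℂ] FockSpace} (h : WeaklyConverges ρ σ) (d : ℕ) :
    Tendsto (fun n => tailWeight (ρ n) d) atTop (𝓝 (tailWeight σ d)) := by
  refine ENNReal.Tendsto.sub tendsto_const_nhds (tendsto_finsetSum _ fun k _ => ?_)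
    (Or.inl ENNReal.one_ne_top)
  exact ENNReal.tendsto_ofReal ((Complex.continuous_re.tendsto _).comp (h.tendsto_inner _ _))

/-- Weak convergence of density operators to a density operator implies convergence in trace
norm. -/
theorem WeaklyConverges.tendsto_traceNorm_sub {ρ : ℕ → FockSpace →L[ℂ] FockSpace}
    {σ : FockSpace →L[ℂ] FockSpace} (h : WeaklyConverges ρ σ) (hρ : ∀ n, IsDensityOperator (ρ n))
    (hσ : IsDensityOperator σ) :
    Tendsto (fun n => traceNorm (ρ n - σ)) atTop (𝓝 0) := by
  set B : ℕ → ℕ → ℝ≥0∞ := fun d n =>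
    2 * tailWeight (ρ n) d ^ (1 / 2 : ℝ) + ((d : ℝ≥0∞) ^ (1 / 2 : ℝ) *
      (∑ k ∈ Finset.range d, ∑ j ∈ Finset.range d,
        ‖(inner ℂ (fockState j) ((ρ n - σ) (fockState k)) : ℂ)‖ₑ ^ 2) ^ (1 / 2 : ℝ) +
      2 * tailWeight σ d ^ (1 / 2 : ℝ)) with hB
  have hle : ∀ d n, traceNorm (ρ n - σ) ≤ B d n := by
    intro d n
    have hdec : ρ n - σ = (ρ n - fockProj d * ρ n * fockProj d) +
        (fockProj d * (ρ n - σ) * fockProj d + -(σ - fockProj d * σ * fockProj d)) := by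
      noncomm_ring
    refine (traceNorm_le_dualTraceNorm _
      ((hρ n).1.isSelfAdjoint.sub hσ.1.isSelfAdjoint)).trans ?_
    conv_lhs => rw [hdec]
    refine (dualTraceNorm_add_le _ _).trans (add_le_add
      ((hρ n).dualTraceNorm_sub_compress_le d) ((dualTraceNorm_add_le _ _).trans (add_le_add
        (dualTraceNorm_compress_le _ d) ?_)))
    rw [dualTraceNorm_neg]
    exact hσ.dualTraceNorm_sub_compress_le d
  have hlim : ∀ d, Tendsto (B d) atTop (𝓝 (4 * tailWeight σ d ^ (1 / 2 : ℝ))) := by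
    intro d
    have h1 : Tendsto (fun n => 2 * tailWeight (ρ n) d ^ (1 / 2 : ℝ)) atTop
        (𝓝 (2 * tailWeight σ d ^ (1 / 2 : ℝ))) :=
      ENNReal.Tendsto.const_mul ((h.tendsto_tailWeight d).ennrpow_const _)
        (Or.inr (by norm_num))
    have h2 : Tendsto (fun n => ∑ k ∈ Finset.range d, ∑ j ∈ Finset.range d,
        ‖(inner ℂ (fockState j) ((ρ n - σ) (fockState k)) : ℂ)‖ₑ ^ 2) atTop (𝓝 0) := by
      rw [← Finset.sum_const_zero (s := Finset.range d)]
      refine tendsto_finsetSum _ fun k _ => ?_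
      rw [← Finset.sum_const_zero (s := Finset.range d)]
      refine tendsto_finsetSum _ fun j _ => ?_
      have h3 := (h.tendsto_inner (fockState j) (fockState k)).sub_const
        (inner ℂ (fockState j) (σ (fockState k)))
      rw [sub_self] at h3
      have h4 := ((continuous_enorm.tendsto _).comp h3)
      have h5 := ((ENNReal.continuous_pow 2).tendsto _).comp h4
      simpa [Function.comp_def, inner_sub_right, sub_apply] using h5
    have h3 := ENNReal.Tendsto.const_mul (a := (d : ℝ≥0∞) ^ (1 / 2 : ℝ))
      (h2.ennrpow_const (1 / 2 : ℝ))
      (Or.inr (ENNReal.rpow_ne_top_of_nonneg (by norm_num) (ENNReal.natCast_ne_top d)))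
    rw [ENNReal.zero_rpow_of_pos (by norm_num), mul_zero] at h3
    have h4 := h1.add (h3.add_const (2 * tailWeight σ d ^ (1 / 2 : ℝ)))
    rw [zero_add, ← add_mul] at h4
    convert! h4 using 3
    norm_num
  have hlim' : Tendsto (fun d => 4 * tailWeight σ d ^ (1 / 2 : ℝ)) atTop (𝓝 0) := by
    have := ENNReal.Tendsto.const_mul (a := 4)
      (hσ.tendsto_tailWeight_atTop.ennrpow_const (1 / 2 : ℝ)) (Or.inr (by norm_num))
    rwa [ENNReal.zero_rpow_of_pos (by norm_num), mul_zero] at this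
  -- The cutoff `d` is chosen first, from the tail of `σ` alone; only then does `n` grow.
  refine ENNReal.tendsto_nhds_zero.mpr fun ε hε => ?_
  obtain ⟨d, hd⟩ := (hlim'.eventually_lt_const hε).exists
  exact ((hlim d).eventually_lt_const hd).mono fun n hn => (hle d n).trans hn.le
-- Coherent states and their mixtures
theorem isPositive_of_inner_nonneg {T : FockSpace →L[ℂ] FockSpace}
    (h : ∀ f, 0 ≤ (inner ℂ f (T f)).re ∧ (inner ℂ f (T f)).im = 0) : T.IsPositive := by
  refine (ContinuousLinearMap.isPositive_iff_complex T).mpr fun f => ?_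
  rw [← inner_conj_symm]
  obtain ⟨hre, him⟩ := h f
  exact ⟨Complex.ext (by simp) (by rw [Complex.conj_im, him]; simp),
    by rw [RCLike.conj_re]; exact hre⟩

theorem ext_inner_fockState {S T : FockSpace →L[ℂ] FockSpace}
    (h : ∀ j k, (inner ℂ (fockState j) (S (fockState k)) : ℂ) =
      inner ℂ (fockState j) (T (fockState k))) : S = T := by
  have hd := fockBasis.dense_span
  rw [funext fockBasis_apply] at hd
  refine ContinuousLinearMap.ext_on (Submodule.dense_iff_topologicalClosure_eq_top.mpr hd) ?_
  rintro _ ⟨k, rfl⟩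
  have h0 := tsum_enorm_inner_fockState_sq (S (fockState k) - T (fockState k))
  simp only [inner_sub_right, h, sub_self] at h0
  simpa [sub_eq_zero] using h0.symm

theorem inner_fockState_coherentState (k : ℕ) (α : ℂ) :
    (inner ℂ (fockState k) (coherentState α) : ℂ) =
      ((Real.exp (-‖α‖ ^ 2 / 2) : ℝ) : ℂ) * (α ^ k / ((√(k.factorial : ℝ) : ℝ) : ℂ)) := by
  refine (lp.inner_single_left (𝕜 := ℂ) (G := fun _ : ℕ => ℂ) k (1 : ℂ) _).trans ?_
  simp [coherentState]

theorem norm_inner_fockState_coherentState_sq (k : ℕ) (α : ℂ) :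
    ‖(inner ℂ (fockState k) (coherentState α) : ℂ)‖ ^ 2 =
      Real.exp (-‖α‖ ^ 2) * ((‖α‖ ^ 2) ^ k / k.factorial) := by
  rw [inner_fockState_coherentState, norm_mul, norm_div, norm_pow, Complex.norm_real,
    Complex.norm_real, Real.norm_of_nonneg (Real.exp_pos _).le,
    Real.norm_of_nonneg (Real.sqrt_nonneg _), mul_pow, div_pow, Real.sq_sqrt (Nat.cast_nonneg _),
    ← Real.exp_nat_mul, ← pow_mul, ← pow_mul, mul_comm k]
  congr 2
  push_cast
  ring

theorem norm_coherentState (α : ℂ) : ‖coherentState α‖ = 1 := by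
  have h1 := hasSum_norm_inner_fockState_sq (coherentState α)
  simp_rw [norm_inner_fockState_coherentState_sq] at h1
  have h2 := (NormedSpace.expSeries_div_hasSum_exp (‖α‖ ^ 2)).mul_left (Real.exp (-‖α‖ ^ 2))
  rw [← Real.exp_eq_exp_ℝ, ← Real.exp_add, neg_add_cancel, Real.exp_zero] at h2
  exact (pow_eq_one_iff_of_nonneg (norm_nonneg _) two_ne_zero).mp (h1.unique h2)

/-- The truncated Fock expansions are continuous in `α` and converge pointwise. -/
theorem stronglyMeasurable_coherentState : StronglyMeasurable coherentState := by
  refine stronglyMeasurable_of_tendsto atTop (f := fun n α => ∑ k ∈ Finset.range n,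
    (inner ℂ (fockState k) (coherentState α) : ℂ) • fockState k) (fun n => ?_)
    (tendsto_pi_nhds.mpr fun α => ?_)
  · refine Continuous.stronglyMeasurable (continuous_finsetSum _ fun k _ => ?_)
    simp_rw [inner_fockState_coherentState]
    fun_prop
  · have h := (fockBasis.hasSum_repr (coherentState α)).tendsto_sum_nat
    simpa only [HilbertBasis.repr_apply_apply, fockBasis_apply] using h

theorem norm_ketbra_coherentState (α : ℂ) : ‖ketbra (coherentState α)‖ = 1 := by
  rw [ketbra, InnerProductSpace.norm_rankOne, norm_coherentState, mul_one]

theorem continuous_ketbra : Continuous ketbra := by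
  have h : Continuous fun f : FockSpace =>
      ContinuousLinearMap.smulRightL ℂ FockSpace FockSpace (innerSL ℂ f) f :=
    (ContinuousLinearMap.continuous₂ _).comp ((innerSL ℂ).continuous.prodMk continuous_id)
  exact h

theorem integrable_ketbra_coherentState (μ : Measure ℂ) [IsFiniteMeasure μ] :
    Integrable (fun α => ketbra (coherentState α)) μ :=
  Integrable.of_bound
    (continuous_ketbra.comp_stronglyMeasurable stronglyMeasurable_coherentState).aestronglyMeasurable
    1 (ae_of_all _ fun α => (norm_ketbra_coherentState α).le)

theorem inner_ketbra (h f g : FockSpace) :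
    (inner ℂ f (ketbra h g) : ℂ) = inner ℂ f h * inner ℂ h g := by
  rw [ketbra, InnerProductSpace.rankOne_apply, inner_smul_right, mul_comm]

theorem inner_coherentMixture (μ : Measure ℂ) [IsFiniteMeasure μ] (f g : FockSpace) :
    (inner ℂ f (coherentMixture μ g) : ℂ) =
      ∫ α, inner ℂ f (coherentState α) * inner ℂ (coherentState α) g ∂μ := by
  have h := ((innerSL ℂ f).comp (ContinuousLinearMap.apply ℂ FockSpace g)).integral_comp_comm
    (integrable_ketbra_coherentState μ)
  simp only [ContinuousLinearMap.comp_apply, ContinuousLinearMap.apply_apply, innerSL_apply_apply,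
    inner_ketbra] at h
  exact h.symm

theorem inner_self_coherentMixture (μ : Measure ℂ) [IsFiniteMeasure μ] (f : FockSpace) :
    (inner ℂ f (coherentMixture μ f) : ℂ) =
      ((∫ α, ‖(inner ℂ f (coherentState α) : ℂ)‖ ^ 2 ∂μ : ℝ) : ℂ) := by
  rw [inner_coherentMixture, ← integral_complex_ofReal]
  refine integral_congr_ae (ae_of_all _ fun α => ?_)
  simp only
  rw [← inner_conj_symm _ f, Complex.mul_conj, Complex.normSq_eq_norm_sq]

theorem isPositive_coherentMixture (μ : Measure ℂ) [IsFiniteMeasure μ] :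
    (coherentMixture μ).IsPositive := by
  refine isPositive_of_inner_nonneg fun f => ?_
  rw [inner_self_coherentMixture]
  exact ⟨integral_nonneg fun α => by positivity, Complex.ofReal_im _⟩

theorem isDensityOperator_coherentMixture (μ : Measure ℂ) [IsProbabilityMeasure μ] :
    IsDensityOperator (coherentMixture μ) := by
  refine ⟨isPositive_coherentMixture μ, ?_⟩
  rw [← Complex.ofReal_one]
  refine hasTrace_of_isPositive (isPositive_coherentMixture μ) ?_
  simp_rw [inner_self_coherentMixture, Complex.ofReal_re]
  have hm : ∀ k, StronglyMeasurable fun α =>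
      (inner ℂ (fockState k) (coherentState α) : ℂ) := fun k =>
    (innerSL ℂ (fockState k)).continuous.comp_stronglyMeasurable stronglyMeasurable_coherentState
  -- By Tonelli and Parseval, the trace is the integral of `‖coherentState α‖ ^ 2 = 1`.
  have h1 : ∑' k, ∫⁻ α, ‖(inner ℂ (fockState k) (coherentState α) : ℂ)‖ₑ ^ 2 ∂μ = 1 := by
    rw [← lintegral_tsum fun k => ((hm k).enorm.pow_const 2).aemeasurable]
    simp_rw [tsum_enorm_inner_fockState_sq, ← ofReal_norm, norm_coherentState]
    simp
  have h2 := ENNReal.hasSum_toReal (h1.trans_ne ENNReal.one_ne_top)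
  rw [← ENNReal.tsum_toReal_eq (ENNReal.ne_top_of_tsum_ne_top (h1.trans_ne ENNReal.one_ne_top)),
    h1, ENNReal.toReal_one] at h2
  convert! h2 using 2 with k
  rw [integral_eq_lintegral_of_nonneg_ae (ae_of_all _ fun α => by positivity)]
  · simp_rw [← ofReal_norm, ENNReal.ofReal_pow (norm_nonneg _)]
  · exact ((hm k).norm.pow 2).aestronglyMeasurable

/-! ### The complex Gaussian law -/

theorem integral_norm_pow_mul_exp {b : ℝ} (hb : 0 < b) (k : ℕ) :
    ∫ z : ℂ, ‖z‖ ^ (2 * k) * Real.exp (-b * ‖z‖ ^ 2) =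
      Real.pi * k.factorial / b ^ (k + 1) := by
  have h := Complex.integral_rpow_mul_exp_neg_mul_rpow (p := 2) (q := (2 * k : ℕ)) one_le_two
    (by have : (0 : ℝ) ≤ (2 * k : ℕ) := Nat.cast_nonneg _
        linarith) hb
  simp only [Real.rpow_natCast, Real.rpow_ofNat] at h
  rw [h]
  have h1 : (((2 * k : ℕ) : ℝ) + 2) / 2 = (k : ℝ) + 1 := by push_cast; ring
  rw [neg_div, h1, Real.Gamma_nat_eq_factorial, Real.rpow_neg hb.le]
  norm_cast
  field_simp

theorem complexGaussian_univ {m : ℝ} (hm : 0 < m) : complexGaussian m Set.univ = 1 := by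
  have h := integral_norm_pow_mul_exp (inv_pos.mpr hm) 0
  have hpi := Real.pi_pos
  have h1 : ∫ z : ℂ, (Real.pi * m)⁻¹ * Real.exp (-‖z‖ ^ 2 / m) = 1 := by
    rw [integral_const_mul]
    have : ∀ z : ℂ, Real.exp (-‖z‖ ^ 2 / m) =
        ‖z‖ ^ (2 * 0) * Real.exp (-m⁻¹ * ‖z‖ ^ 2) := fun z => by
      rw [mul_zero, pow_zero, one_mul]
      congr 1
      ring
    simp_rw [this, h]
    simp
    field_simp
  rw [complexGaussian, withDensity_apply _ MeasurableSet.univ, Measure.restrict_univ,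
    ← ofReal_integral_eq_lintegral_ofReal
      -- A nonzero Bochner integral forces integrability, since its default value is zero.
      (not_imp_comm.1 integral_undef (h1 ▸ one_ne_zero)) (ae_of_all _ fun z => by positivity), h1,
    ENNReal.ofReal_one]

theorem isProbabilityMeasure_complexGaussian {m : ℝ} (hm : 0 < m) :
    IsProbabilityMeasure (complexGaussian m) := ⟨complexGaussian_univ hm⟩

theorem integral_complexGaussian {m : ℝ} (hm : 0 < m) (f : ℂ → ℂ) :
    ∫ z, f z ∂complexGaussian m =
      ∫ z, ((Real.pi * m)⁻¹ * Real.exp (-‖z‖ ^ 2 / m)) • f z := by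
  rw [complexGaussian, integral_withDensity_eq_integral_toReal_smul (by fun_prop)
    (ae_of_all _ fun z => ENNReal.ofReal_lt_top)]
  refine integral_congr_ae (ae_of_all _ fun z => ?_)
  simp only
  rw [ENNReal.toReal_ofReal (by have := Real.pi_pos; positivity)]

theorem integral_complexGaussian_rotate {m : ℝ} (hm : 0 < m) (c : Circle) (f : ℂ → ℂ) :
    ∫ z, f (c * z) ∂complexGaussian m = ∫ z, f z ∂complexGaussian m := by
  rw [integral_complexGaussian hm, integral_complexGaussian hm]
  have h := (rotation c).measurePreserving.integral_comp'
    (f := (rotation c).toHomeomorph.toMeasurableEquiv)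
    (fun z => ((Real.pi * m)⁻¹ * Real.exp (-‖z‖ ^ 2 / m)) • f z)
  rw [← h]
  refine integral_congr_ae (ae_of_all _ fun z => ?_)
  change _ = ((Real.pi * m)⁻¹ * Real.exp (-‖(c : ℂ) * z‖ ^ 2 / m)) • f (c * z)
  rw [norm_mul, Circle.norm_coe, one_mul]

/-! ### The thermal state -/

/-- Rotation by `θ = π / (j - k)` preserves the Gaussian law and multiplies the integrand by `exp (i
θ (j - k)) = -1`, so the integral equals its own negative. -/
theorem inner_gaussianState_of_ne {m : ℝ} (hm : 0 < m) {j k : ℕ} (hjk : j ≠ k) :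
    (inner ℂ (fockState j) (gaussianState m (fockState k)) : ℂ) = 0 := by
  have := isProbabilityMeasure_complexGaussian hm
  rw [gaussianState, inner_coherentMixture]
  set f : ℂ → ℂ := fun α =>
    inner ℂ (fockState j) (coherentState α) * inner ℂ (coherentState α) (fockState k)
  set θ : ℝ := Real.pi / ((j : ℝ) - k)
  have hθ : ((j : ℂ) - k) ≠ 0 := sub_ne_zero.mpr (Nat.cast_injective.ne hjk)
  have hc : ∀ α, f (Circle.exp θ * α) = -f α := by
    intro α
    simp only [f]
    rw [← inner_conj_symm _ (fockState k), ← inner_conj_symm _ (fockState k)]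
    simp only [inner_fockState_coherentState, norm_mul, Circle.norm_coe, one_mul, map_mul, map_div₀,
      map_pow, Complex.conj_ofReal, mul_pow]
    have hmul : (Circle.exp θ : ℂ) ^ j * (starRingEnd ℂ (Circle.exp θ : ℂ)) ^ k = -1 := by
      rw [Circle.coe_exp, ← Complex.exp_conj, ← Complex.exp_nat_mul, ← Complex.exp_nat_mul,
        ← Complex.exp_add, ← Complex.exp_pi_mul_I]
      congr 1
      simp only [θ, map_mul, Complex.conj_ofReal, Complex.conj_I]
      push_cast
      field_simp
      ring
    linear_combination (((Real.exp (-‖α‖ ^ 2 / 2) : ℝ) : ℂ) ^ 2 *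
      (α ^ j / ((√(j.factorial : ℝ) : ℝ) : ℂ)) *
      (starRingEnd ℂ α ^ k / ((√(k.factorial : ℝ) : ℝ) : ℂ))) * hmul
  have h := integral_complexGaussian_rotate hm (Circle.exp θ) f
  simp_rw [hc, integral_neg] at h
  exact self_eq_neg.mp h.symm

theorem inner_self_gaussianState {m : ℝ} (hm : 0 < m) (k : ℕ) :
    (inner ℂ (fockState k) (gaussianState m (fockState k)) : ℂ) =
      ((m ^ k / (m + 1) ^ (k + 1) : ℝ) : ℂ) := by
  have := isProbabilityMeasure_complexGaussian hm
  have hpi := Real.pi_pos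
  rw [gaussianState, inner_self_coherentMixture, ← integral_complex_ofReal,
    integral_complexGaussian hm]
  have h : ∀ z : ℂ, ((Real.pi * m)⁻¹ * Real.exp (-‖z‖ ^ 2 / m)) •
      ((‖(inner ℂ (fockState k) (coherentState z) : ℂ)‖ ^ 2 : ℝ) : ℂ) =
      (((Real.pi * m)⁻¹ / k.factorial *
        (‖z‖ ^ (2 * k) * Real.exp (-(m⁻¹ + 1) * ‖z‖ ^ 2)) : ℝ) : ℂ) := by
    intro z
    rw [norm_inner_fockState_coherentState_sq, Complex.real_smul, ← Complex.ofReal_mul]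
    congr 1
    rw [show -(m⁻¹ + 1) * ‖z‖ ^ 2 = -‖z‖ ^ 2 / m + -‖z‖ ^ 2 by ring, Real.exp_add, pow_mul]
    ring
  simp_rw [h]
  rw [integral_complex_ofReal, integral_const_mul, integral_norm_pow_mul_exp (by positivity)]
  congr 1
  have hk : (k.factorial : ℝ) ≠ 0 := by positivity
  rw [show m⁻¹ + 1 = (m + 1) / m by field_simp; ring, div_pow]
  field_simp
  ring

theorem inner_fockState_gaussianState {m : ℝ} (hm : 0 < m) (j k : ℕ) :
    (inner ℂ (fockState j) (gaussianState m (fockState k)) : ℂ) =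
      if j = k then ((m ^ k / (m + 1) ^ (k + 1) : ℝ) : ℂ) else 0 := by
  split_ifs with h
  · rw [h, inner_self_gaussianState hm]
  · exact inner_gaussianState_of_ne hm h

theorem hasSum_thermal_weight {m : ℝ} (hm : 0 < m) (d : ℕ) :
    HasSum (fun k => m ^ (k + d) / (m + 1) ^ (k + d + 1)) ((m / (m + 1)) ^ d) := by
  have hr : m / (m + 1) < 1 := (div_lt_one (by positivity)).mpr (by linarith)
  have h := (hasSum_geometric_of_lt_one (by positivity) hr).mul_left ((m / (m + 1)) ^ d / (m + 1))
  convert! h using 1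
  · ext k
    rw [div_pow, div_pow]
    field_simp
    ring
  · have : 1 - m / (m + 1) = (m + 1)⁻¹ := by field_simp; ring
    rw [this, inv_inv]
    field_simp

theorem hasSum_gaussianState {m : ℝ} (hm : 0 < m) :
    HasSum (fun k : ℕ => ((m ^ k / (m + 1) ^ (k + 1) : ℝ) : ℂ) • ketbra (fockState k))
      (gaussianState m) := by
  have hs : Summable fun k : ℕ =>
      ((m ^ k / (m + 1) ^ (k + 1) : ℝ) : ℂ) • ketbra (fockState k) := by
    refine Summable.of_norm ((hasSum_thermal_weight hm 0).summable.congr fun k => ?_)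
    rw [norm_smul, ketbra, InnerProductSpace.norm_rankOne, norm_fockState, Complex.norm_real,
      Real.norm_of_nonneg (by positivity)]
    simp
  -- The series converges in operator norm, so its sum can be identified by matrix entries.
  convert! hs.hasSum
  refine ext_inner_fockState fun j k => ?_
  rw [inner_fockState_gaussianState hm]
  have h := hs.hasSum.mapL ((innerSL ℂ (fockState j)).comp
    (ContinuousLinearMap.apply ℂ FockSpace (fockState k)))
  refine HasSum.unique ?_ h
  convert! hasSum_ite_eq k (if j = k then ((m ^ k / (m + 1) ^ (k + 1) : ℝ) : ℂ) else 0) using 2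
    with i
  simp only [ContinuousLinearMap.comp_apply, ContinuousLinearMap.apply_apply, innerSL_apply_apply,
    smul_apply, ketbra_fockState_apply, inner_smul_right]
  by_cases hik : i = k
  · simp [hik, inner_fockState_fockState]
  · simp [hik]

theorem isDensityOperator_gaussianState {m : ℝ} (hm : 0 < m) :
    IsDensityOperator (gaussianState m) :=
  have := isProbabilityMeasure_complexGaussian hm
  isDensityOperator_coherentMixture _

theorem gaussianState_fockState {m : ℝ} (hm : 0 < m) (k : ℕ) :
    gaussianState m (fockState k) =
      ((m ^ k / (m + 1) ^ (k + 1) : ℝ) : ℂ) • fockState k := by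
  have h : gaussianState m * ketbra (fockState k) =
      ((m ^ k / (m + 1) ^ (k + 1) : ℝ) : ℂ) • ketbra (fockState k) := by
    refine ext_inner_fockState fun i j => ?_
    rw [mul_apply_eq_comp, smul_apply, ketbra_fockState_apply, inner_smul_right]
    split_ifs with hkj
    · rw [inner_fockState_gaussianState hm, inner_fockState_fockState, hkj]
      simp
    · simp
  simpa [mul_apply_eq_comp, ketbra_fockState_apply] using congr($h (fockState k))

theorem hasTrace_gaussianState_mul {m : ℝ} (hm : 0 < m) (d : ℕ) :
    HasTrace (gaussianState m * (1 - fockProj d)) (((m / (m + 1)) ^ d : ℝ) : ℂ) := by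
  -- Both factors are diagonal, so the product is a two-sided compression of a positive operator and
  -- its trace norm is the sum of its diagonal.
  have hconj : gaussianState m * (1 - fockProj d) =
      star (1 - fockProj d) * gaussianState m * (1 - fockProj d) := by
    refine ext_inner_fockState fun j k => ?_
    simp only [mul_apply_eq_comp, sub_apply, one_apply_eq_self, fockProj_fockState, star_sub,
      star_one, (isSelfAdjoint_fockProj d).star_eq]
    split_ifs with h <;> simp [gaussianState_fockState hm, fockProj_fockState, h]
  have hpos : (gaussianState m * (1 - fockProj d)).IsPositive := by
    rw [hconj, ← ContinuousLinearMap.nonneg_iff_isPositive]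
    exact star_left_conjugate_nonneg ((ContinuousLinearMap.nonneg_iff_isPositive _).mpr
      (isDensityOperator_gaussianState hm).1) _
  refine hasTrace_of_isPositive hpos ((hasSum_nat_add_iff' d).mp ?_)
  have hdiag : ∀ k, (inner ℂ (fockState k)
      ((gaussianState m * (1 - fockProj d)) (fockState k)) : ℂ).re =
        if k < d then 0 else m ^ k / (m + 1) ^ (k + 1) := by
    intro k
    simp only [mul_apply_eq_comp, sub_apply, one_apply_eq_self, fockProj_fockState]
    split_ifs with h
    · simp
    · rw [sub_zero, inner_self_gaussianState hm, Complex.ofReal_re]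
  simp_rw [hdiag]
  rw [Finset.sum_eq_zero fun k hk => if_pos (Finset.mem_range.mp hk), sub_zero]
  simpa using hasSum_thermal_weight hm d

/-! ### The approximation bound -/

/-- The trace norms tend to zero and the right-hand side is positive and independent of `n`; nothing
else about the constant `6` is used. -/
theorem WeaklyConverges.eventually_traceNorm_sub_le {m : ℝ} (hm : 0 < m)
    {ρ : ℕ → FockSpace →L[ℂ] FockSpace} (hρ : ∀ n, IsDensityOperator (ρ n))
    (h : WeaklyConverges ρ (gaussianState m)) (d : ℕ) :
    ∀ᶠ n in atTop, traceNorm (ρ n - gaussianState m) ≤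
      ENNReal.ofReal (6 * (m / (m + 1)) ^ d) :=
  ENNReal.tendsto_nhds_zero.mp
    (h.tendsto_traceNorm_sub hρ (isDensityOperator_gaussianState hm)) _
    (ENNReal.ofReal_pos.mpr (by positivity))

theorem proposition1 (m : ℝ) (hm : 0 < m) :
    -- `ρ_{X_G}` is the thermal state with mean photon number `m`
    HasSum (fun k : ℕ => ((m ^ k / (m + 1) ^ (k + 1) : ℝ) : ℂ) • ketbra (fockState k))
      (gaussianState m) ∧
    IsDensityOperator (gaussianState m) ∧
    -- its weight outside the range of `P_d`
    (∀ d : ℕ, HasTrace (gaussianState m * (1 - fockProj d)) (((m / (m + 1)) ^ d : ℝ) : ℂ)) ∧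
    -- the approximation error of weakly convergent density operators
    (∀ ρ : ℕ → FockSpace →L[ℂ] FockSpace, (∀ n, IsDensityOperator (ρ n)) →
      WeaklyConverges ρ (gaussianState m) →
      ∀ d : ℕ, ∀ᶠ n in atTop,
        traceNorm (ρ n - gaussianState m) ≤ ENNReal.ofReal (6 * (m / (m + 1)) ^ d)) ∧
    -- mixtures of coherent states are density operators, so that the bound holds for them
    (∀ μ : ℕ → Measure ℂ, (∀ n, IsProbabilityMeasure (μ n)) →
      (∀ n, IsDensityOperator (coherentMixture (μ n))) ∧
      (WeaklyConverges (fun n => coherentMixture (μ n)) (gaussianState m) →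
        ∀ d : ℕ, ∀ᶠ n in atTop,
          traceNorm (coherentMixture (μ n) - gaussianState m) ≤
            ENNReal.ofReal (6 * (m / (m + 1)) ^ d))) := by
  refine ⟨hasSum_gaussianState hm, isDensityOperator_gaussianState hm,
    hasTrace_gaussianState_mul hm, fun ρ hρ h => h.eventually_traceNorm_sub_le hm hρ,
    fun μ hμ => ?_⟩
  have hd := fun n => isDensityOperator_coherentMixture (μ n)
  exact ⟨hd, fun h => h.eventually_traceNorm_sub_le hm hd⟩
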